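/- \textbf{Setting.} Let $L\ge 1$, let $p_0=d,p_1,\dots,p_L\ge 1$ and $p_{L+1}=1$ be integers, and let $\mathcal A$ be the set of all $\Theta=(W^L,\dots,W^0)$ with $W^l\in\mathbb R^{p_{l+1}\times p_l}$. Put $P=\sum_{l=0}^{L}p_{l+1}p_l$, $\|\Theta\|_1=\sum_{l,k,j}|W^l_{kj}|$ and $\mathcal A_1=\{\Theta\in\mathcal A:\|\Theta\|_1\le 1\}$. Let the activation functions $f^l:\mathbb R^{p_l}\to\mathbb R^{p_l}$, $l=1,\dots,L$, satisfy $f^l(0)=0$ and be $a_{\mathrm{Lip}}$-Lipschitz for the Euclidean norms, where $a_{\mathrm{Lip}}\in[0,\infty)$, and let $g_\Theta:\mathbb R^d\to\mathbb R$, $g_\Theta(x)=W^Lf^L(\cdots W^1f^1(W^0x))$. Let $x_1,\dots,x_n\in\mathbb R^d$ be fixed, $\|x\|_n=\bigl(\sum_{i=1}^n\|x_i\|^2/n\bigr)^{1/2}$, and $y_i=g_*(x_i)+u_i$ for a function $g_*:\mathbb R^d\to\mathbb R$, where $u_1,\dots,u_n$ are independent, centered random variables with $K^2\bigl(\mathbb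 E e^{|u_i|^2/K^2}-1\bigr)\le\gamma^2$ for all $i$, for constants $K,\gamma\in(0,\infty)$. For $\lambda\ge 0$ let $$(\hat\kappa,\hat\Omega)\in\operatorname*{arg\,min}_{\kappa\in[0,\infty),\ \Omega\in\mathcal A_1}\Bigl\{\frac1n\sum_{i=1}^n\bigl(y_i-\kappa g_\Omega(x_i)\bigr)^2+\lambda\kappa\Bigr\}$$ be any minimizer, and let $\operatorname{err}^2(\kappa g_\Omega)=\frac1n\sum_{i=1}^n\bigl(\kappa g_\Omega(x_i)-g_*(x_i)\bigr)^2$. \textbf{Corollary (parametric setting).} For all $K,\gamma\in(0,\infty)$ there are a constant $a\in(0,\infty)$ and an $n_0$, both depending only on $K$ and $\gamma$, such that the following holds for all $n\ge n_0$ in every such setting. Assume that $$\lambda=a\Bigl(\frac{2a_{\mathrm{Lip}}}{L}\Bigr)^L\|x\|_n\sqrt{L\log(2P)}\,\frac{\log(2n)}{\sqrt n}$$ and that there exists $(\kappa_*,\Omega_*)\in[0,\infty)\times\mathcal A_1$ with $\kappa_*g_{\Omega_*}(x_i)=g_*(x_i)$ for all $i\in\{1,\dots,n\}$. Then, with probability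 at least $1-\frac1{2n}$, every minimizer $(\hat\kappa,\hat\Omega)$ satisfies $$\operatorname{err}^2(\hat\kappa g_{\hat\Omega})\le 2a\kappa_*\Bigl(\frac{2a_{\mathrm{Lip}}}{L}\Bigr)^L\|x\|_n\sqrt{L\log(2P)}\,\frac{\log(2n)}{\sqrt n}.$$ -/

import Mathlib

open MeasureTheory ProbabilityTheory

noncomputable section

namespace ScaleReg

/-- The architecture of a feedforward network: the number `L ≥ 1` of hidden layers and the widths
`p 0, …, p (L + 1) ≥ 1`, with a single output neuron. The input dimension is `d = p 0`. Values
`p l` with `l > L + 1` are never used. -/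
structure Architecture where
  L : ℕ
  one_le_L : 1 ≤ L
  p : ℕ → ℕ
  one_le_p : ∀ l ≤ L + 1, 1 ≤ p l
  p_out : p (L + 1) = 1

namespace Architecture

/-- The space of the neurons of layer `l`, with the Euclidean norm. -/
abbrev Layer (A : Architecture) (l : ℕ) : Type := EuclideanSpace ℝ (Fin (A.p l))

/-- The parameter space: families of weight matrices `W 0, …, W L` of sizes
`p (l + 1) × p l`. -/
abbrev Params (A : Architecture) : Type :=
  (l : Fin (A.L + 1)) → Matrix (Fin (A.p (l + 1))) (Fin (A.p l)) ℝ

/-- The total number of parameters, `P = ∑ l, p (l + 1) * p l`. -/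
def P (A : Architecture) : ℕ := ∑ l ∈ Finset.range (A.L + 1), A.p (l + 1) * A.p l

/-- The activation functions. Only those of the layers `1, …, L` are used. -/
abbrev Activations (A : Architecture) : Type := (l : ℕ) → A.Layer l → A.Layer l

end Architecture

variable {A : Architecture}

/-- The map `z ↦ W z` between Euclidean spaces. -/
def applyMat {m k : ℕ} (W : Matrix (Fin m) (Fin k) ℝ) (z : EuclideanSpace ℝ (Fin k)) :
    EuclideanSpace ℝ (Fin m) :=
  WithLp.toLp 2 (W.mulVec (WithLp.ofLp z))

/-- The output of layer `l ≤ L` after activation: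
`hidden 0 = x` and `hidden (l + 1) = act (l + 1) (W l (hidden l))`. -/
def hidden (act : A.Activations) (W : A.Params) (x : A.Layer 0) :
    (l : ℕ) → l ≤ A.L → A.Layer l
  | 0, _ => x
  | l + 1, h =>
      act (l + 1) (applyMat (W ⟨l, by omega⟩) (hidden act W x l (by omega)))

/-- The network `g_W x = W^L act^L (… W^1 act^1 (W^0 x))`, a real number since the output layer
has one neuron. -/
def net (act : A.Activations) (W : A.Params) (x : A.Layer 0) : ℝ :=
  applyMat (W ⟨A.L, Nat.lt_succ_self _⟩) (hidden act W x A.L le_rfl)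
    ⟨0, A.one_le_p (A.L + 1) le_rfl⟩

/-- The `ℓ₁`-norm of a parameter, the sum of the absolute values of all entries of all weight
matrices. -/
def normOne (W : A.Params) : ℝ := ∑ l, ∑ k, ∑ j, |W l k j|

/-- The unit ball `{W | h W ≤ 1}` of a function `h` on the parameter space. -/
def unitBall (h : A.Params → ℝ) : Set A.Params := {W | h W ≤ 1}

/-- The empirical norm of the inputs, `(∑ i, ‖x i‖² / n)^(1/2)`. -/
def inputNorm {n : ℕ} (x : Fin n → A.Layer 0) : ℝ := √((∑ i, ‖x i‖ ^ 2) / n)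

/-- The in-sample prediction error of `κ g_W`, relative to the function `gstar`. -/
def predErr {n : ℕ} (act : A.Activations) (x : Fin n → A.Layer 0) (gstar : A.Layer 0 → ℝ)
    (κ : ℝ) (W : A.Params) : ℝ :=
  √(1 / n * ∑ i, (κ * net act W (x i) - gstar (x i)) ^ 2)

/-- The least-squares objective with regularization of the scale `κ`. -/
def objective {n : ℕ} (act : A.Activations) (x : Fin n → A.Layer 0) (y : Fin n → ℝ) (lam : ℝ)
    (q : ℝ × A.Params) : ℝ :=
  1 / n * ∑ i, (y i - q.1 * net act q.2 (x i)) ^ 2 + lam * q.1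

/-- `q = (κ, W)` is a scale-regularized estimator: it minimizes the objective over
`[0, ∞) × {W | h W ≤ 1}`. -/
def IsEstimator {n : ℕ} (h : A.Params → ℝ) (act : A.Activations) (x : Fin n → A.Layer 0)
    (y : Fin n → ℝ) (lam : ℝ) (q : ℝ × A.Params) : Prop :=
  q ∈ Set.Ici (0 : ℝ) ×ˢ unitBall h ∧
    IsMinOn (objective act x y lam) (Set.Ici (0 : ℝ) ×ˢ unitBall h) q

/-- The activation functions of the layers `1, …, L` map zero to zero and are `aLip`-Lipschitz for
the Euclidean norms. -/
def LipschitzActivations (act : A.Activations) (aLip : ℝ) : Prop :=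
  ∀ l, 1 ≤ l → l ≤ A.L →
    act l 0 = 0 ∧ ∀ z z' : A.Layer l, ‖act l z - act l z'‖ ≤ aLip * ‖z - z'‖

/-- The noise variables are independent, centered, and uniformly sub-Gaussian for the constants
`K` and `γ`. -/
structure IsSubGaussianNoise {Ω : Type*} [MeasurableSpace Ω] (μ : Measure Ω) {n : ℕ}
    (u : Fin n → Ω → ℝ) (K γ : ℝ) : Prop where
  measurable : ∀ i, Measurable (u i)
  indep : iIndepFun u μ
  centered : ∀ i, ∫ ω, u i ω ∂μ = 0
  integrable_exp : ∀ i, Integrable (fun ω => Real.exp (|u i ω| ^ 2 / K ^ 2)) μ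
  exp_moment : ∀ i, K ^ 2 * (∫ ω, Real.exp (|u i ω| ^ 2 / K ^ 2) ∂μ - 1) ≤ γ ^ 2

end ScaleReg

end

/-!
The proof compares the estimator with the true parameter. By the basic inequality
(`predErr_sq_le_of_isEstimator`), the squared prediction error is at most `2 λ κ*` as soon as `λ`
dominates `2 / n * |∑ i, u i * g_W (x i)|` simultaneously for all `W` in the `ℓ₁` unit ball. So
everything rests on a uniform bound for this process, which holds with probability
`1 - 1 / (2 n)`.

Two deterministic facts control the size of the process. First, on the `ℓ₁` ball the map `W ↦ g_W`
is Lipschitz for the Frobenius norm, with a constant of order `(2 aLip / L) ^ L * √L * ‖x‖`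
(`abs_net_toParams_sub_le`): a change in one layer is amplified by the norms of the `L` other
layers, whose sum is bounded. Second, every point of the `ℓ₁` ball of `ℝ ^ P` is within `2 / √m` of
an average of `m` signed basis vectors (`exists_norm_sub_average_le`), and there are only
`(2 P) ^ m` such averages.

For fixed weights the process is a linear combination of the noise, which is sub-Gaussian
(`hasSubgaussianMGF_of_integral_exp_sq_le`). Chaining through the averages of `J 2 ^ k` basis
vectors, `k ≤ J`, with `J` of order `log (2 n)`, then gives `exists_event_forall_l1Ball_le`: each of
the `J` scales contributes a multiple of `√(log (2 P))`, because the length `1 / √m` of a link and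
the deviation `√(m log (2 P))` needed for the union bound cancel. Below the finest scale, the
Cauchy-Schwarz inequality and a bound for `∑ i, u i ^ 2` suffice.
-/

namespace ScaleReg

/-! ### Sub-Gaussian noise -/

lemma exp_le_add_exp_sq (x : ℝ) : Real.exp x ≤ x + Real.exp (x ^ 2) := by
  have h2 := Real.add_one_le_exp (x ^ 2)
  rcases le_or_gt |x| 1 with h | h
  · have h1 := (abs_le.1 (Real.abs_exp_sub_one_sub_id_le h)).2
    linarith
  · rcases lt_abs.1 h with h | h
    · have : Real.exp x ≤ Real.exp (x ^ 2) := Real.exp_le_exp.2 (by nlinarith)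
      linarith
    · have : Real.exp x ≤ 1 := Real.exp_le_one_iff.2 (by linarith)
      nlinarith

lemma exp_mul_le_of_mem_Icc {s : ℝ} (h0 : 0 ≤ s) (h1 : s ≤ 1) (w : ℝ) :
    Real.exp (s * w) ≤ 1 - s + s * Real.exp w := by
  have := convexOn_exp.2 (Set.mem_univ 0) (Set.mem_univ w) (sub_nonneg.2 h1) h0 (by ring)
  simpa using this

/-- A centered variable whose square has an exponential moment is sub-Gaussian. For `|t| K ≤ 1`
the linear term of `exp (t X) ≤ t X + exp (t² X²)` has mean zero, and for `|t| K ≥ 1` the centering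
is not needed. -/
lemma hasSubgaussianMGF_of_integral_exp_sq_le {Ω : Type*} [MeasurableSpace Ω] {μ : Measure Ω}
    [IsProbabilityMeasure μ] {X : Ω → ℝ} {K γ : ℝ} (hK : 0 < K) (hX : Measurable X)
    (hcent : ∫ ω, X ω ∂μ = 0) (hint : Integrable (fun ω => Real.exp (|X ω| ^ 2 / K ^ 2)) μ)
    (hmom : K ^ 2 * (∫ ω, Real.exp (|X ω| ^ 2 / K ^ 2) ∂μ - 1) ≤ γ ^ 2) :
    HasSubgaussianMGF X (Real.toNNReal (2 * K ^ 2 + 2 * γ ^ 2)) μ := by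
  have hc : ((Real.toNNReal (2 * K ^ 2 + 2 * γ ^ 2) : NNReal) : ℝ) = 2 * K ^ 2 + 2 * γ ^ 2 :=
    Real.coe_toNNReal _ (by positivity)
  simp only [sq_abs] at hint hmom
  set V : Ω → ℝ := fun ω => Real.exp (X ω ^ 2 / K ^ 2) with hV
  have hintX : Integrable X μ := by
    refine Integrable.mono' (hint.const_mul K) hX.aestronglyMeasurable (ae_of_all _ fun ω => ?_)
    have h1 := Real.add_one_le_exp (X ω ^ 2 / K ^ 2)
    have h2 : |X ω| = K * (|X ω| / K) := by field_simp
    have h3 : X ω ^ 2 / K ^ 2 = (|X ω| / K) ^ 2 := by rw [div_pow, sq_abs]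
    rw [Real.norm_eq_abs, h2]
    refine mul_le_mul_of_nonneg_left ?_ hK.le
    nlinarith [sq_nonneg (|X ω| / K - 1 / 2)]
  have hpt : ∀ t ω, Real.exp (t * X ω) ≤ Real.exp (t ^ 2 * K ^ 2 / 2) * ((1 + V ω) / 2) := by
    intro t ω
    have h1 : t * X ω ≤ t ^ 2 * K ^ 2 / 2 + 1 / 2 * (X ω ^ 2 / K ^ 2) := by
      have : t * X ω = (t * K) * (X ω / K) := by field_simp
      rw [this, ← div_pow]
      nlinarith [sq_nonneg (t * K - X ω / K)]
    refine (Real.exp_le_exp.2 h1).trans ?_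
    rw [Real.exp_add]
    have := exp_mul_le_of_mem_Icc (s := 1 / 2) (by norm_num) (by norm_num) (X ω ^ 2 / K ^ 2)
    refine mul_le_mul_of_nonneg_left ?_ (Real.exp_pos _).le
    simp only [hV]
    linarith
  have hbint : ∀ t : ℝ, Integrable
      (fun ω => Real.exp (t ^ 2 * K ^ 2 / 2) * ((1 + V ω) / 2)) μ := fun t =>
    (((integrable_const 1).add hint).div_const 2).const_mul _
  have hexp : ∀ t : ℝ, Integrable (fun ω => Real.exp (t * X ω)) μ := fun t => by
    refine Integrable.mono' (hbint t) (by fun_prop) (ae_of_all _ fun ω => ?_)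
    rw [Real.norm_eq_abs, abs_of_pos (Real.exp_pos _)]
    exact hpt t ω
  have hmom' : ∫ ω, V ω ∂μ ≤ 1 + γ ^ 2 / K ^ 2 := by
    have : ∫ ω, V ω ∂μ - 1 ≤ γ ^ 2 / K ^ 2 := by
      rw [le_div_iff₀ (by positivity)]; linarith
    linarith
  refine ⟨hexp, fun t => ?_⟩
  rw [hc, mgf]
  rcases le_or_gt (t ^ 2 * K ^ 2) 1 with hs | hs
  · have hs0 : 0 ≤ t ^ 2 * K ^ 2 := by positivity
    have hI : Integrable (fun ω => t * X ω + ((1 - t ^ 2 * K ^ 2) + t ^ 2 * K ^ 2 * V ω)) μ :=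
      (hintX.const_mul t).add ((integrable_const _).add (hint.const_mul _))
    calc ∫ ω, Real.exp (t * X ω) ∂μ
        ≤ ∫ ω, (t * X ω + ((1 - t ^ 2 * K ^ 2) + t ^ 2 * K ^ 2 * V ω)) ∂μ := by
          refine integral_mono (hexp t) hI fun ω => ?_
          have h1 := exp_le_add_exp_sq (t * X ω)
          have h2 := exp_mul_le_of_mem_Icc hs0 hs (X ω ^ 2 / K ^ 2)
          have h3 : t ^ 2 * K ^ 2 * (X ω ^ 2 / K ^ 2) = (t * X ω) ^ 2 := by field_simp
          rw [h3] at h2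
          simp only [hV]
          linarith
      _ = 1 - t ^ 2 * K ^ 2 + t ^ 2 * K ^ 2 * ∫ ω, V ω ∂μ := by
          have h5 : Integrable (fun ω => 1 - t ^ 2 * K ^ 2 + t ^ 2 * K ^ 2 * V ω) μ :=
            (integrable_const _).add (hint.const_mul _)
          rw [integral_add (hintX.const_mul t) h5,
            integral_add (integrable_const _) (hint.const_mul _), integral_const_mul,
            integral_const_mul, hcent]
          simp
      _ ≤ t ^ 2 * γ ^ 2 + 1 := by
          have := mul_le_mul_of_nonneg_left hmom' hs0
          have h4 : t ^ 2 * K ^ 2 * (1 + γ ^ 2 / K ^ 2) = t ^ 2 * K ^ 2 + t ^ 2 * γ ^ 2 := by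
            field_simp
          linarith
      _ ≤ Real.exp (t ^ 2 * γ ^ 2) := Real.add_one_le_exp _
      _ ≤ _ := Real.exp_le_exp.2 (by nlinarith [sq_nonneg t])
  · calc ∫ ω, Real.exp (t * X ω) ∂μ
        ≤ ∫ ω, Real.exp (t ^ 2 * K ^ 2 / 2) * ((1 + V ω) / 2) ∂μ :=
          integral_mono (hexp t) (hbint t) (hpt t)
      _ = Real.exp (t ^ 2 * K ^ 2 / 2) * ((1 + ∫ ω, V ω ∂μ) / 2) := by
          rw [integral_const_mul, integral_div, integral_add (integrable_const _) hint]
          simp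
      _ ≤ Real.exp (t ^ 2 * K ^ 2 / 2) * Real.exp (t ^ 2 * γ ^ 2 / 2) := by
          refine mul_le_mul_of_nonneg_left ?_ (Real.exp_pos _).le
          have h1 := Real.add_one_le_exp (t ^ 2 * γ ^ 2 / 2)
          have h2 : γ ^ 2 / K ^ 2 ≤ t ^ 2 * γ ^ 2 := by
            rw [div_le_iff₀ (by positivity)]
            nlinarith [sq_nonneg γ]
          linarith
      _ ≤ _ := by
          rw [← Real.exp_add]
          exact Real.exp_le_exp.2 (by nlinarith [sq_nonneg (t * K), sq_nonneg (t * γ)])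

/-- The common scale of the sub-Gaussian tails and of the size of the noise. -/
noncomputable def noiseScale (K γ : ℝ) : ℝ := √(2 * K ^ 2 + 2 * γ ^ 2)

lemma noiseScale_pos {K : ℝ} (hK : 0 < K) (γ : ℝ) : 0 < noiseScale K γ :=
  Real.sqrt_pos.2 (by positivity)

lemma noiseScale_sq (K γ : ℝ) : noiseScale K γ ^ 2 = 2 * K ^ 2 + 2 * γ ^ 2 :=
  Real.sq_sqrt (by positivity)

namespace IsSubGaussianNoise

variable {Ω : Type*} [MeasurableSpace Ω] {μ : Measure Ω} [IsProbabilityMeasure μ] {n : ℕ}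
  {u : Fin n → Ω → ℝ} {K γ : ℝ}

/-- The inequality in the event is strict, so that the bound also holds for `r = 0`. -/
lemma measureReal_lt_sum_mul_le (hu : IsSubGaussianNoise μ u K γ) (hK : 0 < K) {b : Fin n → ℝ}
    {r s : ℝ} (hr : 0 ≤ r) (hb : ∑ i, b i ^ 2 ≤ r ^ 2) (hs : 0 ≤ s) :
    μ.real {ω | s * (noiseScale K γ * r) < |∑ i, u i ω * b i|} ≤ 2 * Real.exp (-s ^ 2 / 2) := by
  have hσ := noiseScale_pos hK γ
  rcases hr.eq_or_lt with rfl | hr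
  · have hb0 : ∀ i, b i = 0 := fun i => by
      have h1 : b i ^ 2 ≤ ∑ i, b i ^ 2 :=
        Finset.single_le_sum (fun i _ => sq_nonneg (b i)) (Finset.mem_univ i)
      exact pow_eq_zero_iff (two_ne_zero) |>.1 (le_antisymm (by simpa using h1.trans hb)
        (sq_nonneg _))
    simp only [hb0, mul_zero, Finset.sum_const_zero, abs_zero, lt_self_iff_false, Set.ofPred_false,
      measureReal_empty]
    positivity
  set c : NNReal := Real.toNNReal (2 * K ^ 2 + 2 * γ ^ 2)
  have hc : (c : ℝ) = noiseScale K γ ^ 2 := by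
    rw [noiseScale_sq]; exact Real.coe_toNNReal _ (by positivity)
  have hsub : ∀ i, HasSubgaussianMGF (u i) c μ := fun i =>
    hasSubgaussianMGF_of_integral_exp_sq_le hK (hu.measurable i) (hu.centered i)
      (hu.integrable_exp i) (hu.exp_moment i)
  have key : ∀ b : Fin n → ℝ, ∑ i, b i ^ 2 ≤ r ^ 2 →
      μ.real {ω | s * (noiseScale K γ * r) ≤ ∑ i, u i ω * b i} ≤ Real.exp (-s ^ 2 / 2) := by
    intro b hb
    have hind : iIndepFun (fun i ω => b i * u i ω) μ :=
      hu.indep.comp (fun i z => b i * z) (fun i => measurable_const_mul (b i))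
    have hS := HasSubgaussianMGF.sum_of_iIndepFun hind (s := Finset.univ)
      (fun i _ => (hsub i).const_mul (b i))
    have hS' : HasSubgaussianMGF (fun ω => ∑ i, u i ω * b i)
        (Real.toNNReal (noiseScale K γ ^ 2 * r ^ 2)) μ := by
      simp only [mul_comm (b _)] at hS
      refine ⟨hS.integrable_exp_mul, fun t => (hS.mgf_le t).trans (Real.exp_le_exp.2 ?_)⟩
      have h1 : (Real.toNNReal (noiseScale K γ ^ 2 * r ^ 2) : ℝ) = noiseScale K γ ^ 2 * r ^ 2 :=
        Real.coe_toNNReal _ (by positivity)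
      rw [h1]
      push_cast
      have h2 : ∑ i, b i ^ 2 * (c : ℝ) ≤ noiseScale K γ ^ 2 * r ^ 2 := by
        rw [← Finset.sum_mul, hc, mul_comm]
        gcongr
      gcongr
      exact h2
    refine (hS'.measure_ge_le (by positivity)).trans (Real.exp_le_exp.2 (le_of_eq ?_))
    rw [Real.coe_toNNReal _ (by positivity)]
    field_simp
  calc μ.real {ω | s * (noiseScale K γ * r) < |∑ i, u i ω * b i|}
      ≤ μ.real ({ω | s * (noiseScale K γ * r) ≤ ∑ i, u i ω * b i} ∪
          {ω | s * (noiseScale K γ * r) ≤ ∑ i, u i ω * (-b i)}) := by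
        refine measureReal_mono fun ω hω => ?_
        simp only [mul_neg, Finset.sum_neg_distrib, Set.mem_union, Set.mem_ofPred_eq] at hω ⊢
        exact (lt_abs.1 hω).imp le_of_lt le_of_lt
    _ ≤ _ := measureReal_union_le _ _
    _ ≤ Real.exp (-s ^ 2 / 2) + Real.exp (-s ^ 2 / 2) :=
        add_le_add (key b hb) (key _ (by simpa using hb))
    _ = _ := by ring

lemma measureReal_lt_sum_sq_le (hu : IsSubGaussianNoise μ u K γ) (hK : 0 < K) :
    μ.real {ω | n * noiseScale K γ ^ 2 < ∑ i, u i ω ^ 2} ≤ Real.exp (-(2 * n)) := by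
  have hind : iIndepFun (fun i ω => u i ω ^ 2) μ :=
    hu.indep.comp (fun _ z => z ^ 2) (fun _ => by fun_prop)
  have hm : ∀ i, Measurable fun ω => u i ω ^ 2 := fun i => (hu.measurable i).pow_const 2
  have hint : ∀ i, Integrable (fun ω => Real.exp ((K ^ 2)⁻¹ * u i ω ^ 2)) μ := fun i => by
    have := hu.integrable_exp i
    simpa only [sq_abs, div_eq_inv_mul] using this
  have hmgf : ∀ i, mgf (fun ω => u i ω ^ 2) μ (K ^ 2)⁻¹ ≤ Real.exp (γ ^ 2 / K ^ 2) := fun i => by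
    have h := hu.exp_moment i
    simp only [sq_abs, div_eq_inv_mul] at h
    have h1 : mgf (fun ω => u i ω ^ 2) μ (K ^ 2)⁻¹ - 1 ≤ γ ^ 2 / K ^ 2 := by
      rw [le_div_iff₀ (by positivity), mul_comm]; exact h
    linarith [Real.add_one_le_exp (γ ^ 2 / K ^ 2)]
  have hI := hind.integrable_exp_mul_sum (t := (K ^ 2)⁻¹) hm (s := Finset.univ)
    (fun i _ => hint i)
  have h := measure_ge_le_exp_mul_mgf (μ := μ) (n * noiseScale K γ ^ 2)
    (by positivity : 0 ≤ (K ^ 2)⁻¹) hI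
  rw [hind.mgf_sum hm] at h
  calc μ.real {ω | n * noiseScale K γ ^ 2 < ∑ i, u i ω ^ 2}
      ≤ _ := measureReal_mono (fun ω hω => by
        simpa only [Set.mem_ofPred_eq, Finset.sum_apply] using le_of_lt hω)
    _ ≤ _ := h
    _ ≤ Real.exp (-(K ^ 2)⁻¹ * (n * noiseScale K γ ^ 2)) *
        ∏ _i : Fin n, Real.exp (γ ^ 2 / K ^ 2) := by
        gcongr with i
        · exact fun i _ => mgf_nonneg
        · exact hmgf i
    _ ≤ Real.exp (-(2 * n)) := by
        rw [Finset.prod_const, Finset.card_univ, Fintype.card_fin, ← Real.exp_nat_mul,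
          ← Real.exp_add, noiseScale_sq]
        refine Real.exp_le_exp.2 ?_
        have : -(K ^ 2)⁻¹ * (n * (2 * K ^ 2 + 2 * γ ^ 2)) + n * (γ ^ 2 / K ^ 2)
            = -(2 * n) - n * (γ ^ 2 / K ^ 2) := by
          field_simp
          ring
        rw [this]
        have : 0 ≤ n * (γ ^ 2 / K ^ 2) := by positivity
        linarith

end IsSubGaussianNoise

/-! ### Sparse approximation in the `ℓ₁` ball -/

section Sparse

variable {ι : Type*} [Fintype ι]

/-- The `ℓ₁` unit ball, as a subset of the Euclidean space in which distances are measured. -/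
def l1Ball (ι : Type*) [Fintype ι] : Set (EuclideanSpace ℝ ι) := {v | ∑ i, |v i| ≤ 1}

lemma norm_le_one_of_mem_l1Ball {v : EuclideanSpace ℝ ι} (hv : v ∈ l1Ball ι) : ‖v‖ ≤ 1 := by
  have h1 : ∑ i, ‖v i‖ ^ 2 ≤ (∑ i, ‖v i‖) ^ 2 :=
    Finset.sum_sq_le_sq_sum_of_nonneg fun i _ => norm_nonneg _
  have h2 : (∑ i, ‖v i‖) ^ 2 ≤ 1 := by
    have h3 : ∑ i, ‖v i‖ ≤ 1 := hv
    have : 0 ≤ ∑ i, ‖v i‖ := Finset.sum_nonneg fun i _ => norm_nonneg _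
    nlinarith
  rw [EuclideanSpace.norm_eq, Real.sqrt_le_left zero_le_one, one_pow]
  exact h1.trans h2

lemma zero_mem_l1Ball : (0 : EuclideanSpace ℝ ι) ∈ l1Ball ι := by
  simp [l1Ball]

variable [DecidableEq ι]

/-- The vertices of the `ℓ₁` ball, the signed standard basis vectors. -/
noncomputable def atom (a : ι × Bool) : EuclideanSpace ℝ ι :=
  EuclideanSpace.single a.1 (if a.2 then 1 else -1)

lemma sum_abs_atom (a : ι × Bool) : ∑ i, |atom a i| = 1 := by
  have : ∀ i, |atom a i| = if i = a.1 then 1 else 0 := fun i => by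
    simp only [atom, PiLp.single_apply]
    split_ifs <;> simp
  simp [this]

lemma norm_atom_le (a : ι × Bool) : ‖atom a‖ ≤ 1 :=
  norm_le_one_of_mem_l1Ball (sum_abs_atom a).le

/-- A linear functional is minimized over the `ℓ₁` ball at a vertex. -/
lemma exists_inner_atom_le [Nonempty ι] (D : EuclideanSpace ℝ ι) {v : EuclideanSpace ℝ ι}
    (hv : v ∈ l1Ball ι) : ∃ a : ι × Bool, inner ℝ D (atom a) ≤ inner ℝ D v := by
  obtain ⟨j, -, hj⟩ := Finset.exists_max_image Finset.univ (fun i => |D i|) Finset.univ_nonempty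
  have h1 : ∃ b : Bool, inner ℝ D (atom (j, b)) = -|D j| := by
    rcases le_total 0 (D j) with h | h
    · exact ⟨false, by simp [atom, EuclideanSpace.inner_single_right, abs_of_nonneg h]⟩
    · exact ⟨true, by simp [atom, EuclideanSpace.inner_single_right, abs_of_nonpos h]⟩
  obtain ⟨b, hb⟩ := h1
  refine ⟨(j, b), hb.le.trans ?_⟩
  have h2 : |inner ℝ D v| ≤ |D j| := by
    rw [PiLp.inner_apply]
    calc |∑ i, inner ℝ (D i) (v i)| ≤ ∑ i, |inner ℝ (D i) (v i)| := Finset.abs_sum_le_sum_abs _ _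
      _ ≤ ∑ i, |D j| * |v i| := by
        refine Finset.sum_le_sum fun i hi => ?_
        simp only [RCLike.inner_apply, conj_trivial, abs_mul]
        rw [mul_comm]
        exact mul_le_mul_of_nonneg_right (hj i hi) (abs_nonneg _)
      _ ≤ |D j| := by
        rw [← Finset.mul_sum]
        exact mul_le_of_le_one_right (abs_nonneg _) hv
  exact neg_le_of_abs_le h2

/-- Maurey's sparsification: `m` vertices whose sum is at distance at most `2 √m` from `m v`.
They are chosen greedily, the difference to `v` of each one making an angle of at least `π / 2`
with the current error, so that the squared error grows by at most `4` per step. -/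
lemma exists_norm_sum_atom_sub_sq_le [Nonempty ι] {v : EuclideanSpace ℝ ι} (hv : v ∈ l1Ball ι)
    (m : ℕ) : ∃ s : Fin m → ι × Bool, ‖∑ k, atom (s k) - (m : ℝ) • v‖ ^ 2 ≤ 4 * m := by
  induction m with
  | zero => exact ⟨Fin.elim0, by simp⟩
  | succ m ih =>
    obtain ⟨s, hs⟩ := ih
    obtain ⟨a, ha⟩ := exists_inner_atom_le (∑ k, atom (s k) - (m : ℝ) • v) hv
    refine ⟨Fin.snoc s a, ?_⟩
    have h1 : ∑ k, atom ((Fin.snoc s a : Fin (m + 1) → ι × Bool) k) - ((m + 1 : ℕ) : ℝ) • v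
        = (∑ k, atom (s k) - (m : ℝ) • v) + (atom a - v) := by
      rw [Fin.sum_univ_castSucc]
      simp only [Fin.snoc_castSucc, Fin.snoc_last, Nat.cast_add, Nat.cast_one, add_smul, one_smul]
      abel
    have h2 : ‖atom a - v‖ ≤ 2 := by
      have := norm_sub_le (atom a) v
      linarith [norm_atom_le a, norm_le_one_of_mem_l1Ball hv]
    rw [h1, norm_add_sq_real, inner_sub_right]
    push_cast
    nlinarith [norm_nonneg (atom a - v)]

/-- The average of a family of vertices of the `ℓ₁` ball, and `0` for the empty family. -/
noncomputable def average {m : ℕ} (s : Fin m → ι × Bool) : EuclideanSpace ℝ ι :=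
  (m : ℝ)⁻¹ • ∑ k, atom (s k)

lemma average_mem_l1Ball {m : ℕ} (hm : m ≠ 0) (s : Fin m → ι × Bool) : average s ∈ l1Ball ι := by
  have hm' : (0 : ℝ) < m := by positivity
  have h : ∀ i, |average s i| ≤ (m : ℝ)⁻¹ * ∑ k, |atom (s k) i| := fun i => by
    simp only [average, PiLp.smul_apply, smul_eq_mul, abs_mul, WithLp.ofLp_sum, Finset.sum_apply]
    rw [abs_of_pos (inv_pos.2 hm')]
    gcongr
    exact Finset.abs_sum_le_sum_abs _ _
  calc ∑ i, |average s i| ≤ ∑ i, (m : ℝ)⁻¹ * ∑ k, |atom (s k) i| :=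
        Finset.sum_le_sum fun i _ => h i
    _ = 1 := by
        rw [← Finset.mul_sum, Finset.sum_comm]
        simp only [sum_abs_atom]
        simp [hm'.ne']
    _ ≤ 1 := le_rfl

lemma exists_norm_sub_average_le [Nonempty ι] {v : EuclideanSpace ℝ ι} (hv : v ∈ l1Ball ι)
    {m : ℕ} (hm : m ≠ 0) : ∃ s : Fin m → ι × Bool, ‖v - average s‖ ≤ 2 / √m := by
  obtain ⟨s, hs⟩ := exists_norm_sum_atom_sub_sq_le hv m
  have hm' : (0 : ℝ) < m := by positivity
  refine ⟨s, ?_⟩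
  have h1 : v - average s = -((m : ℝ)⁻¹ • (∑ k, atom (s k) - (m : ℝ) • v)) := by
    rw [average, smul_sub, inv_smul_smul₀ hm'.ne', neg_sub]
  have h2 : ‖∑ k, atom (s k) - (m : ℝ) • v‖ ≤ 2 * √m := by
    refine abs_le_of_sq_le_sq' ?_ (by positivity) |>.2
    rw [mul_pow, Real.sq_sqrt hm'.le]
    linarith
  rw [h1, norm_neg, norm_smul, norm_inv, Real.norm_of_nonneg hm'.le]
  calc (m : ℝ)⁻¹ * ‖∑ k, atom (s k) - (m : ℝ) • v‖ ≤ (m : ℝ)⁻¹ * (2 * √m) := by gcongr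
    _ = 2 / √m := by
      have := Real.mul_self_sqrt hm'.le
      field_simp
      rw [Real.sq_sqrt hm'.le]

end Sparse

/-! ### Lipschitz dependence of the network on its weights -/

/-- The Frobenius norm of a matrix. -/
noncomputable def frob {m k : ℕ} (W : Matrix (Fin m) (Fin k) ℝ) : ℝ := √(∑ i, ∑ j, W i j ^ 2)

lemma frob_nonneg {m k : ℕ} (W : Matrix (Fin m) (Fin k) ℝ) : 0 ≤ frob W := Real.sqrt_nonneg _

lemma frob_le_sum_abs {m k : ℕ} (W : Matrix (Fin m) (Fin k) ℝ) :
    frob W ≤ ∑ i, ∑ j, |W i j| := by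
  refine Real.sqrt_le_iff.2 ⟨by positivity, ?_⟩
  simp only [← Fintype.sum_prod_type', ← sq_abs (W _ _)]
  exact Finset.sum_sq_le_sq_sum_of_nonneg fun _ _ => abs_nonneg _

lemma norm_applyMat_le {m k : ℕ} (W : Matrix (Fin m) (Fin k) ℝ) (z : EuclideanSpace ℝ (Fin k)) :
    ‖applyMat W z‖ ≤ frob W * ‖z‖ := by
  rw [frob, EuclideanSpace.norm_eq, EuclideanSpace.norm_eq, ← Real.sqrt_mul (by positivity)]
  refine Real.sqrt_le_sqrt ?_
  rw [Finset.sum_mul]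
  refine Finset.sum_le_sum fun i _ => ?_
  simp only [applyMat, Matrix.mulVec, dotProduct, Real.norm_eq_abs, sq_abs]
  exact Finset.sum_mul_sq_le_sq_mul_sq _ _ _

lemma applyMat_sub_applyMat {m k : ℕ} (W V : Matrix (Fin m) (Fin k) ℝ)
    (z z' : EuclideanSpace ℝ (Fin k)) :
    applyMat W z - applyMat V z' = applyMat W (z - z') + applyMat (W - V) z' := by
  simp only [applyMat, WithLp.ofLp_sub, Matrix.mulVec_sub, Matrix.sub_mulVec, ← WithLp.toLp_sub,
    ← WithLp.toLp_add]
  congr 1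
  abel

lemma norm_applyMat_sub_applyMat_le {m k : ℕ} (W V : Matrix (Fin m) (Fin k) ℝ)
    (z z' : EuclideanSpace ℝ (Fin k)) :
    ‖applyMat W z - applyMat V z'‖ ≤ frob W * ‖z - z'‖ + frob (W - V) * ‖z'‖ := by
  rw [applyMat_sub_applyMat]
  exact (norm_add_le _ _).trans (add_le_add (norm_applyMat_le _ _) (norm_applyMat_le _ _))

section Network

variable {A : Architecture} {act : A.Activations} {aLip : ℝ}

lemma norm_hidden_le (ha : 0 ≤ aLip) (hact : LipschitzActivations act aLip) (W : A.Params)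
    {β : ℕ → ℝ} (hβ : ∀ l (h : l < A.L + 1), frob (W ⟨l, h⟩) ≤ β l) (x : A.Layer 0) :
    ∀ l (h : l ≤ A.L), ‖hidden act W x l h‖ ≤ aLip ^ l * ‖x‖ * ∏ j ∈ Finset.range l, β j := by
  intro l
  induction l with
  | zero => intro h; simp [hidden]
  | succ l ih =>
    intro h
    have ih := ih (by omega)
    have hl := hact (l + 1) (by omega) h
    set z := applyMat (W ⟨l, by omega⟩) (hidden act W x l (by omega)) with hz
    have h1 : ‖act (l + 1) z‖ ≤ aLip * ‖z‖ := by
      have := hl.2 z 0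
      rwa [hl.1, sub_zero, sub_zero] at this
    have h2 : ‖z‖ ≤ β l * (aLip ^ l * ‖x‖ * ∏ j ∈ Finset.range l, β j) := by
      refine (norm_applyMat_le _ _).trans ?_
      have := hβ l (by omega)
      have h0 := (frob_nonneg _).trans this
      gcongr
    calc ‖hidden act W x (l + 1) h‖ = ‖act (l + 1) z‖ := by rw [hidden]
      _ ≤ aLip * (β l * (aLip ^ l * ‖x‖ * ∏ j ∈ Finset.range l, β j)) :=
        h1.trans (mul_le_mul_of_nonneg_left h2 ha)
      _ = _ := by rw [Finset.prod_range_succ]; ring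

lemma sum_mul_prod_erase_range_succ (β d : ℕ → ℝ) (l : ℕ) :
    ∑ i ∈ Finset.range (l + 1), d i * ∏ j ∈ (Finset.range (l + 1)).erase i, β j
      = β l * (∑ i ∈ Finset.range l, d i * ∏ j ∈ (Finset.range l).erase i, β j)
        + d l * ∏ j ∈ Finset.range l, β j := by
  rw [Finset.sum_range_succ, Finset.mul_sum]
  congr 1
  · refine Finset.sum_congr rfl fun i hi => ?_
    have hil : l ≠ i := (Finset.mem_range.1 hi).ne'
    rw [Finset.range_add_one, Finset.erase_insert_of_ne hil, Finset.prod_insert (by simp)]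
    ring
  · rw [Finset.range_add_one, Finset.erase_insert (by simp)]

/-- The layerwise telescoping bound, with the factor of the perturbed layer replaced by the size of
the perturbation. -/
lemma norm_hidden_sub_hidden_le (ha : 0 ≤ aLip) (hact : LipschitzActivations act aLip)
    (W V : A.Params) {β d : ℕ → ℝ} (hβW : ∀ l (h : l < A.L + 1), frob (W ⟨l, h⟩) ≤ β l)
    (hβV : ∀ l (h : l < A.L + 1), frob (V ⟨l, h⟩) ≤ β l)
    (hd : ∀ l (h : l < A.L + 1), frob (W ⟨l, h⟩ - V ⟨l, h⟩) ≤ d l) (x : A.Layer 0) :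
    ∀ l (h : l ≤ A.L), ‖hidden act W x l h - hidden act V x l h‖
      ≤ aLip ^ l * ‖x‖ * ∑ i ∈ Finset.range l, d i * ∏ j ∈ (Finset.range l).erase i, β j := by
  intro l
  induction l with
  | zero => intro h; simp [hidden]
  | succ l ih =>
    intro h
    have ih := ih (by omega)
    have hV := norm_hidden_le ha hact V hβV x l (by omega)
    have hl := (hact (l + 1) (by omega) h).2
      (applyMat (W ⟨l, by omega⟩) (hidden act W x l (by omega)))
      (applyMat (V ⟨l, by omega⟩) (hidden act V x l (by omega)))
    have h1 := norm_applyMat_sub_applyMat_le (W ⟨l, by omega⟩) (V ⟨l, by omega⟩)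
      (hidden act W x l (by omega)) (hidden act V x l (by omega))
    have h0 := (frob_nonneg _).trans (hβW l (by omega))
    have h0' := (frob_nonneg _).trans (hd l (by omega))
    rw [hidden, hidden, sum_mul_prod_erase_range_succ]
    refine hl.trans ?_
    rw [pow_succ', mul_assoc, mul_assoc]
    refine mul_le_mul_of_nonneg_left (h1.trans ?_) ha
    calc _ ≤ β l * (aLip ^ l * ‖x‖ *
              ∑ i ∈ Finset.range l, d i * ∏ j ∈ (Finset.range l).erase i, β j)
            + d l * (aLip ^ l * ‖x‖ * ∏ j ∈ Finset.range l, β j) :=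
          add_le_add (mul_le_mul (hβW l _) ih (norm_nonneg _) h0)
            (mul_le_mul (hd l _) hV (norm_nonneg _) h0')
      _ = _ := by ring

lemma abs_net_sub_net_le (ha : 0 ≤ aLip) (hact : LipschitzActivations act aLip)
    (W V : A.Params) {β d : ℕ → ℝ} (hβW : ∀ l (h : l < A.L + 1), frob (W ⟨l, h⟩) ≤ β l)
    (hβV : ∀ l (h : l < A.L + 1), frob (V ⟨l, h⟩) ≤ β l)
    (hd : ∀ l (h : l < A.L + 1), frob (W ⟨l, h⟩ - V ⟨l, h⟩) ≤ d l) (x : A.Layer 0) :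
    |net act W x - net act V x| ≤ aLip ^ A.L * ‖x‖ *
      ∑ i ∈ Finset.range (A.L + 1), d i * ∏ j ∈ (Finset.range (A.L + 1)).erase i, β j := by
  have ih := norm_hidden_sub_hidden_le ha hact W V hβW hβV hd x A.L le_rfl
  have hV := norm_hidden_le ha hact V hβV x A.L le_rfl
  have h1 := norm_applyMat_sub_applyMat_le (W ⟨A.L, A.L.lt_succ_self⟩) (V ⟨A.L, A.L.lt_succ_self⟩)
      (hidden act W x A.L le_rfl) (hidden act V x A.L le_rfl)
  have h0 := (frob_nonneg _).trans (hβW A.L A.L.lt_succ_self)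
  have h0' := (frob_nonneg _).trans (hd A.L A.L.lt_succ_self)
  have h2 : |net act W x - net act V x| ≤
      ‖applyMat (W ⟨A.L, A.L.lt_succ_self⟩) (hidden act W x A.L le_rfl)
      - applyMat (V ⟨A.L, A.L.lt_succ_self⟩) (hidden act V x A.L le_rfl)‖ :=
    PiLp.norm_apply_le (p := 2) (applyMat (W ⟨A.L, A.L.lt_succ_self⟩) (hidden act W x A.L le_rfl)
      - applyMat (V ⟨A.L, A.L.lt_succ_self⟩) (hidden act V x A.L le_rfl))
      ⟨0, A.one_le_p (A.L + 1) le_rfl⟩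
  rw [sum_mul_prod_erase_range_succ]
  refine (h2.trans h1).trans ?_
  calc _ ≤ β A.L * (aLip ^ A.L * ‖x‖ *
            ∑ i ∈ Finset.range A.L, d i * ∏ j ∈ (Finset.range A.L).erase i, β j)
          + d A.L * (aLip ^ A.L * ‖x‖ * ∏ j ∈ Finset.range A.L, β j) :=
        add_le_add (mul_le_mul (hβW A.L _) ih (norm_nonneg _) h0)
          (mul_le_mul (hd A.L _) hV (norm_nonneg _) h0')
    _ = _ := by ring

/-- The inequality of arithmetic and geometric means. -/
lemma prod_le_sum_div_card_pow {ι : Type*} (s : Finset ι) (z : ι → ℝ) (hz : ∀ i ∈ s, 0 ≤ z i) :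
    ∏ i ∈ s, z i ≤ ((∑ i ∈ s, z i) / s.card) ^ s.card := by
  rcases s.eq_empty_or_nonempty with rfl | hs
  · simp
  have hc : (0 : ℝ) < s.card := by exact_mod_cast hs.card_pos
  have h := Real.geom_mean_le_arith_mean s (fun _ => 1) z (fun _ _ => zero_le_one)
    (by simpa using hc) hz
  simp only [Real.rpow_one, Finset.sum_const, nsmul_eq_mul, mul_one, one_mul] at h
  have hp : 0 ≤ ∏ i ∈ s, z i := Finset.prod_nonneg hz
  calc ∏ i ∈ s, z i = ((∏ i ∈ s, z i) ^ (s.card : ℝ)⁻¹) ^ s.card := by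
        rw [← Real.rpow_natCast, ← Real.rpow_mul hp, inv_mul_cancel₀ hc.ne', Real.rpow_one]
    _ ≤ _ := by gcongr

/-- The index set of all entries of all weight matrices. -/
abbrev Entry (A : Architecture) : Type :=
  (l : Fin (A.L + 1)) × (Fin (A.p (l + 1)) × Fin (A.p l))

lemma card_entry (A : Architecture) : Fintype.card (Entry A) = A.P := by
  simp [Architecture.P, Finset.sum_range]

/-- The weight matrices with a given vector of entries. -/
def toParams (v : EuclideanSpace ℝ (Entry A)) : A.Params := fun l k j => v ⟨l, k, j⟩

lemma normOne_toParams (v : EuclideanSpace ℝ (Entry A)) :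
    normOne (toParams v) = ∑ i, |v i| := by
  simp only [normOne, Fintype.sum_sigma, Fintype.sum_prod_type]
  rfl

lemma exists_toParams_eq {W : A.Params} (hW : W ∈ unitBall normOne) :
    ∃ v ∈ l1Ball (Entry A), toParams v = W := by
  have h : toParams (WithLp.toLp 2 fun e : Entry A => W e.1 e.2.1 e.2.2) = W := rfl
  refine ⟨_, ?_, h⟩
  change _ ≤ (1 : ℝ)
  rw [← normOne_toParams, h]
  exact hW

/-- On the `ℓ₁` ball the network is Lipschitz in its weights for the Frobenius norm. Two parameters
of the ball have layer norms summing to at most `2`, so any `L` of the layers contribute at most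
`(2 / L) ^ L` by the inequality of means; the Cauchy-Schwarz inequality over the `L + 1` layers
collects the perturbations. -/
lemma abs_net_toParams_sub_le (ha : 0 ≤ aLip) (hact : LipschitzActivations act aLip)
    {v w : EuclideanSpace ℝ (Entry A)} (hv : v ∈ l1Ball (Entry A)) (hw : w ∈ l1Ball (Entry A))
    (x : A.Layer 0) :
    |net act (toParams v) x - net act (toParams w) x|
      ≤ (2 * aLip / A.L) ^ A.L * √(A.L + 1) * ‖x‖ * ‖v - w‖ := by
  set W := toParams v with hW
  set V := toParams w with hV
  -- `β` dominates the layer norms of both parameters, and `d` measures their layerwise distance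
  set β : ℕ → ℝ := fun l => if h : l < A.L + 1 then frob (W ⟨l, h⟩) + frob (V ⟨l, h⟩) else 0
    with hβ
  set d : ℕ → ℝ := fun l => if h : l < A.L + 1 then frob (W ⟨l, h⟩ - V ⟨l, h⟩) else 0 with hd
  have hβl : ∀ l (h : l < A.L + 1), β l = frob (W ⟨l, h⟩) + frob (V ⟨l, h⟩) :=
    fun l h => dif_pos h
  have hdl : ∀ l (h : l < A.L + 1), d l = frob (W ⟨l, h⟩ - V ⟨l, h⟩) := fun l h => dif_pos h
  have hβ0 : ∀ l, 0 ≤ β l := fun l => by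
    simp only [hβ]; split_ifs
    · exact add_nonneg (frob_nonneg _) (frob_nonneg _)
    · exact le_rfl
  have hd0 : ∀ l, 0 ≤ d l := fun l => by
    simp only [hd]; split_ifs
    · exact frob_nonneg _
    · exact le_rfl
  have hfrob : ∀ v ∈ l1Ball (Entry A), ∑ l, frob (toParams v l) ≤ 1 := fun v hv => by
    refine (Finset.sum_le_sum fun l _ => frob_le_sum_abs _).trans ?_
    exact (normOne_toParams v).le.trans hv
  have hβsum : ∑ l ∈ Finset.range (A.L + 1), β l ≤ 2 := by
    have h1 : ∑ l ∈ Finset.range (A.L + 1), β l = ∑ l, frob (W l) + ∑ l, frob (V l) := by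
      rw [Finset.sum_range, ← Finset.sum_add_distrib]
      exact Finset.sum_congr rfl fun l _ => hβl l l.2
    rw [h1]
    linarith [hfrob v hv, hfrob w hw]
  have hdsum : ∑ l ∈ Finset.range (A.L + 1), d l ^ 2 = ‖v - w‖ ^ 2 := by
    rw [Finset.sum_range, EuclideanSpace.norm_eq, Real.sq_sqrt (by positivity), Fintype.sum_sigma]
    refine Finset.sum_congr rfl fun l _ => ?_
    have h1 : d l = frob (W l - V l) := hdl l l.2
    rw [h1, frob, Real.sq_sqrt (by positivity), Fintype.sum_prod_type]
    simp [hW, hV, toParams]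
  have hdsum' : ∑ l ∈ Finset.range (A.L + 1), d l ≤ √(A.L + 1) * ‖v - w‖ := by
    have h1 := sq_sum_le_card_mul_sum_sq (s := Finset.range (A.L + 1)) (f := d)
    rw [hdsum, Finset.card_range] at h1
    push_cast at h1
    refine abs_le_of_sq_le_sq' ?_ (by positivity) |>.2
    rw [mul_pow, Real.sq_sqrt (by positivity)]
    exact h1
  have hprod : ∀ i ∈ Finset.range (A.L + 1),
      ∏ j ∈ (Finset.range (A.L + 1)).erase i, β j ≤ (2 / A.L) ^ A.L := fun i hi => by
    have h1 := prod_le_sum_div_card_pow ((Finset.range (A.L + 1)).erase i) β fun j _ => hβ0 j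
    rw [Finset.card_erase_of_mem hi, Finset.card_range, Nat.add_sub_cancel] at h1
    refine h1.trans ?_
    have h2 : ∑ j ∈ (Finset.range (A.L + 1)).erase i, β j ≤ 2 :=
      (Finset.sum_le_sum_of_subset_of_nonneg (Finset.erase_subset _ _) fun j _ _ => hβ0 j).trans
        hβsum
    have h3 : 0 ≤ ∑ j ∈ (Finset.range (A.L + 1)).erase i, β j :=
      Finset.sum_nonneg fun j _ => hβ0 j
    gcongr
  have h := abs_net_sub_net_le ha hact W V (β := β) (d := d)
    (fun l h => (hβl l h).symm ▸ le_add_of_nonneg_right (frob_nonneg _))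
    (fun l h => (hβl l h).symm ▸ le_add_of_nonneg_left (frob_nonneg _))
    (fun l h => (hdl l h).ge) x
  refine h.trans ?_
  calc _ ≤ aLip ^ A.L * ‖x‖ * ∑ i ∈ Finset.range (A.L + 1), d i * (2 / A.L) ^ A.L := by
        gcongr with i hi
        · exact hd0 i
        · exact hprod i hi
    _ = (2 * aLip / A.L) ^ A.L * ‖x‖ * ∑ i ∈ Finset.range (A.L + 1), d i := by
        rw [← Finset.sum_mul, mul_comm 2 aLip, mul_div_assoc, mul_pow]; ring
    _ ≤ (2 * aLip / A.L) ^ A.L * ‖x‖ * (√(A.L + 1) * ‖v - w‖) := by gcongr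
    _ = _ := by ring

lemma net_zero (x : A.Layer 0) : net act (0 : A.Params) x = 0 := by
  simp [net, applyMat]

end Network

/-! ### Chaining over the `ℓ₁` ball -/

section Chaining

lemma le_log_two_mul {p : ℕ} (hp : 2 ≤ p) : 2 * Real.log 2 ≤ Real.log (2 * p) := by
  have h : (2 : ℝ) ≤ p := by exact_mod_cast hp
  have h1 : Real.log (2 ^ 2) ≤ Real.log (2 * p) := Real.log_le_log (by norm_num) (by linarith)
  simpa [Real.log_pow] using h1

lemma one_le_log_two_mul {p : ℕ} (hp : 2 ≤ p) : 1 ≤ Real.log (2 * p) := by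
  linarith [le_log_two_mul hp, Real.log_two_gt_d9]

lemma clog_two_mul_le_log {n : ℕ} (hn : 1 ≤ n) :
    (Nat.clog 2 (2 * n) : ℝ) ≤ 3 * Real.log (2 * n) := by
  have h2 := Real.log_two_gt_d9
  have hn' : (1 : ℝ) ≤ n := by exact_mod_cast hn
  have hlog : Real.log 2 ≤ Real.log (2 * n) := Real.log_le_log (by norm_num) (by linarith)
  have h1 : 2 ^ (Nat.clog 2 (2 * n)).pred < 2 * n :=
    Nat.pow_pred_clog_lt_self (by norm_num) (by omega)
  have h3 : (2 : ℝ) ^ (Nat.clog 2 (2 * n)).pred ≤ 2 * n := by exact_mod_cast h1.le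
  have h4 := Real.log_le_log (by positivity) h3
  rw [Real.log_pow] at h4
  have h5 : (Nat.clog 2 (2 * n) : ℝ) ≤ (Nat.clog 2 (2 * n)).pred + 1 := by
    exact_mod_cast Nat.le_succ_of_pred_le le_rfl
  have h6 : 0 ≤ ((Nat.clog 2 (2 * n)).pred : ℝ) := Nat.cast_nonneg _
  nlinarith

/-- The total failure probability of the chaining events, for `J` scales whose nets each have at
least `J` vertices per average. -/
lemma mul_exp_neg_le {n p J : ℕ} (hn : 1 ≤ n) (hp : 2 ≤ p) (hJ : 1 ≤ J) (hJn : 2 * n ≤ 2 ^ J) :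
    (J + 1) * (2 * Real.exp (-(2 * J * Real.log (2 * p)))) ≤ 1 / (4 * n) := by
  have h1 : Real.exp (-(2 * J * Real.log (2 * p))) ≤ ((16 : ℝ) ^ J)⁻¹ := by
    rw [Real.exp_neg]
    refine inv_anti₀ (by positivity) ?_
    have h2 : (16 : ℝ) ^ J = Real.exp (J * (4 * Real.log 2)) := by
      rw [Real.exp_nat_mul, mul_comm, Real.exp_mul, Real.exp_log (by norm_num)]
      norm_num
    rw [h2]
    refine Real.exp_le_exp.2 ?_
    have := mul_le_mul_of_nonneg_left (le_log_two_mul hp) (Nat.cast_nonneg (α := ℝ) J)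
    linarith
  have h3 : J + 1 ≤ 2 ^ J := Nat.lt_two_pow_self
  have h4 : (J + 1 : ℝ) ≤ 2 ^ J := by exact_mod_cast h3
  have h5 : (2 * n : ℝ) ≤ 2 ^ J := by exact_mod_cast hJn
  have h6 : (2 : ℝ) ≤ 2 ^ J := by
    calc (2 : ℝ) = 2 ^ 1 := by norm_num
      _ ≤ 2 ^ J := pow_le_pow_right₀ (by norm_num) hJ
  have h7 : (16 : ℝ) ^ J = 2 ^ J * (2 ^ J * (2 ^ J * 2 ^ J)) := by
    rw [← mul_pow, ← mul_pow, ← mul_pow]; norm_num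
  have hn' : (0 : ℝ) < n := by exact_mod_cast hn
  calc (J + 1) * (2 * Real.exp (-(2 * J * Real.log (2 * p))))
      ≤ 2 ^ J * (2 * ((16 : ℝ) ^ J)⁻¹) := by gcongr
    _ = 2 / (2 ^ J * (2 ^ J * 2 ^ J)) := by rw [h7]; field_simp
    _ ≤ 2 / (2 * n * (2 * 2)) := by gcongr
    _ = 1 / (4 * n) := by field_simp; norm_num

lemma IsSubGaussianNoise.measurableSet_lt_abs_sum_mul {Ω : Type*} [MeasurableSpace Ω]
    {μ : Measure Ω} {n : ℕ} {u : Fin n → Ω → ℝ} {K γ : ℝ} (hu : IsSubGaussianNoise μ u K γ)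
    (t : ℝ) (b : Fin n → ℝ) : MeasurableSet {ω | t < |∑ i, u i ω * b i|} := by
  have := hu.measurable
  exact measurableSet_lt measurable_const (by fun_prop)

variable {Ω : Type*} [MeasurableSpace Ω] {μ : Measure Ω} [IsProbabilityMeasure μ] {n : ℕ}
  {u : Fin n → Ω → ℝ} {K γ : ℝ}

/-- The union bound over one scale of the chain: `(2 p) ^ (3 m)` linear combinations of the noise
with coefficient vectors of length at most `r`. -/
lemma IsSubGaussianNoise.measureReal_iUnion_le (hu : IsSubGaussianNoise μ u K γ) (hK : 0 < K)
    {α : Type*} [Fintype α] {b : α → Fin n → ℝ} {r : ℝ} (hr : 0 ≤ r)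
    (hb : ∀ a, ∑ i, b a i ^ 2 ≤ r ^ 2) {p J m : ℕ} (hp : 2 ≤ p) (hJm : J ≤ m)
    (hcard : Fintype.card α ≤ (2 * p) ^ (3 * m)) :
    μ.real (⋃ a, {ω | 4 * √(m * Real.log (2 * p)) * (noiseScale K γ * r) < |∑ i, u i ω * b a i|})
      ≤ 2 * Real.exp (-(2 * J * Real.log (2 * p))) := by
  have hℓ : 0 ≤ Real.log (2 * p) := zero_le_one.trans (one_le_log_two_mul hp)
  have hp' : (0 : ℝ) < 2 * p := by positivity
  have hcard' : (Fintype.card α : ℝ) ≤ Real.exp (3 * m * Real.log (2 * p)) := by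
    have h1 : (Fintype.card α : ℝ) ≤ (2 * p) ^ (3 * m) := by exact_mod_cast hcard
    refine h1.trans (le_of_eq ?_)
    rw [mul_comm (3 * (m : ℝ)), Real.exp_mul, Real.exp_log hp', ← Real.rpow_natCast]
    norm_num
  refine (measureReal_iUnion_fintype_le _).trans ?_
  calc _ ≤ ∑ _a : α, 2 * Real.exp (-(4 * √(m * Real.log (2 * p))) ^ 2 / 2) :=
        Finset.sum_le_sum fun a _ => hu.measureReal_lt_sum_mul_le hK hr (hb a) (by positivity)
    _ = Fintype.card α * (2 * Real.exp (-(8 * (m * Real.log (2 * p))))) := by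
        rw [Finset.sum_const, nsmul_eq_mul, Finset.card_univ, mul_pow,
          Real.sq_sqrt (by positivity)]
        ring_nf
    _ ≤ Real.exp (3 * m * Real.log (2 * p)) * (2 * Real.exp (-(8 * (m * Real.log (2 * p))))) := by
        gcongr
    _ = 2 * Real.exp (-(5 * (m * Real.log (2 * p)))) := by
        rw [mul_left_comm, ← Real.exp_add]
        ring_nf
    _ ≤ _ := by
        have h1 : (J : ℝ) * Real.log (2 * p) ≤ m * Real.log (2 * p) := by gcongr
        have h2 : 0 ≤ (J : ℝ) * Real.log (2 * p) := by positivity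
        exact mul_le_mul_of_nonneg_left (Real.exp_le_exp.2 (by linarith)) zero_le_two

/-- With high probability, a process that is linear in the noise and Lipschitz in a parameter of
the `ℓ₁` ball is uniformly small. Each parameter is reached through averages of `J`, `2 J`,
`4 J`, … vertices, where `2 ^ J` is about `2 n`. The squared length of a link is inversely
proportional to the logarithm of the number of links of its scale, so all scales contribute equally,
and the number `J` of scales gives the factor `log (2 n)`. Starting with `J` vertices instead of
one makes the failure probability of each scale a small power of `1 / n`. -/
theorem exists_event_forall_l1Ball_le {ι : Type*} [Fintype ι] (hι : 2 ≤ Fintype.card ι)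
    (hu : IsSubGaussianNoise μ u K γ) (hK : 0 < K) (hn : 1 ≤ n)
    {G : EuclideanSpace ℝ ι → Fin n → ℝ} {c : Fin n → ℝ} (hG0 : ∀ i, G 0 i = 0)
    (hG : ∀ v ∈ l1Ball ι, ∀ w ∈ l1Ball ι, ∀ i, |G v i - G w i| ≤ c i * ‖v - w‖) :
    ∃ E : Set Ω, MeasurableSet E ∧ 1 - 1 / (2 * (n : ℝ)) ≤ μ.real E ∧ ∀ ω ∈ E, ∀ v ∈ l1Ball ι,
      |∑ i, u i ω * G v i| ≤ 66 * noiseScale K γ * √(∑ i, c i ^ 2)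
        * √(Real.log (2 * Fintype.card ι)) * Real.log (2 * n) := by
  classical
  have : Nonempty ι := Fintype.card_pos_iff.1 (by omega)
  have hn' : (0 : ℝ) < n := by exact_mod_cast hn
  set p := Fintype.card ι with hp
  set ℓ := Real.log (2 * p) with hℓ
  set σ := noiseScale K γ with hσ
  have hσ0 : 0 < σ := noiseScale_pos hK γ
  set C := √(∑ i, c i ^ 2) with hC
  have hC0 : 0 ≤ C := Real.sqrt_nonneg _
  have hC2 : C ^ 2 = ∑ i, c i ^ 2 := Real.sq_sqrt (by positivity)
  have hℓ1 : 1 ≤ ℓ := one_le_log_two_mul hι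
  set J := Nat.clog 2 (2 * n) with hJ
  have hJ1 : 1 ≤ J := Nat.clog_pos (by norm_num) (by omega)
  have hJn : 2 * n ≤ 2 ^ J := Nat.le_pow_clog (by norm_num) _
  set m : ℕ → ℕ := fun k => J * 2 ^ k with hm
  have hm0 : ∀ k, m k ≠ 0 := fun k => by positivity
  have hmJ : ∀ k, J ≤ m k := fun k => Nat.le_mul_of_pos_right _ (by positivity)
  have hmpos : ∀ k, (0 : ℝ) < m k := fun k => by exact_mod_cast Nat.pos_of_ne_zero (hm0 k)
  have hsq : ∀ v ∈ l1Ball ι, ∀ w ∈ l1Ball ι, ∀ r, ‖v - w‖ ≤ r →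
      ∑ i, (G v i - G w i) ^ 2 ≤ (r * C) ^ 2 := by
    intro v hv w hw r hr
    rw [mul_pow, hC2, Finset.mul_sum]
    refine Finset.sum_le_sum fun i _ => ?_
    rw [← sq_abs]
    calc |G v i - G w i| ^ 2 ≤ (c i * ‖v - w‖) ^ 2 := by gcongr; exact hG v hv w hw i
      _ = ‖v - w‖ ^ 2 * c i ^ 2 := by ring
      _ ≤ r ^ 2 * c i ^ 2 := by gcongr
  have hcardS : ∀ k, Fintype.card (Fin k → ι × Bool) = (2 * p) ^ k := fun k => by
    simp [hp, mul_comm]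
  -- the links between consecutive scales
  let Link : ℕ → Type _ := fun k =>
    {q : (Fin (m k) → ι × Bool) × (Fin (m (k + 1)) → ι × Bool) //
      ‖average q.2 - average q.1‖ ≤ 4 / √(m k)}
  let B₀ : Set Ω := ⋃ s : Fin (m 0) → ι × Bool,
    {ω | 4 * √(m 0 * ℓ) * (σ * (1 * C)) < |∑ i, u i ω * (G (average s) i - G 0 i)|}
  let B : ℕ → Set Ω := fun k => ⋃ q : Link k,
    {ω | 4 * √(m k * ℓ) * (σ * (4 / √(m k) * C))
      < |∑ i, u i ω * (G (average q.1.2) i - G (average q.1.1) i)|}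
  -- the noise vector is so long that the remainder below the finest scale cannot be controlled
  let N : Set Ω := {ω | n * σ ^ 2 < ∑ i, u i ω ^ 2}
  have hB₀ : μ.real B₀ ≤ 2 * Real.exp (-(2 * J * ℓ)) := by
    refine hu.measureReal_iUnion_le hK (by positivity) (fun s => ?_) hι (hmJ 0) ?_
    · refine hsq _ (average_mem_l1Ball (hm0 0) s) _ zero_mem_l1Ball _ ?_
      rw [sub_zero]
      exact norm_le_one_of_mem_l1Ball (average_mem_l1Ball (hm0 0) s)
    · rw [hcardS]
      exact Nat.pow_le_pow_right (by omega) (by omega)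
  have hB : ∀ k, μ.real (B k) ≤ 2 * Real.exp (-(2 * J * ℓ)) := fun k => by
    refine hu.measureReal_iUnion_le hK (by positivity) (fun q => ?_) hι (hmJ k) ?_
    · exact hsq _ (average_mem_l1Ball (hm0 _) _) _ (average_mem_l1Ball (hm0 _) _) _ q.2
    · refine (Fintype.card_subtype_le _).trans ?_
      rw [Fintype.card_prod, hcardS, hcardS, ← pow_add]
      refine Nat.pow_le_pow_right (by omega) (le_of_eq ?_)
      simp only [hm]
      ring
  have hN : μ.real N ≤ 1 / (4 * n) := by
    refine (hu.measureReal_lt_sum_sq_le hK).trans ?_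
    rw [Real.exp_neg, one_div]
    refine inv_anti₀ (by positivity) ?_
    have h1 := Real.add_one_le_exp (n : ℝ)
    rw [two_mul, Real.exp_add]
    nlinarith [sq_nonneg ((n : ℝ) - 1)]
  have hB₀m : MeasurableSet B₀ :=
    MeasurableSet.iUnion fun s => hu.measurableSet_lt_abs_sum_mul _ _
  have hBm : ∀ k, MeasurableSet (B k) := fun k =>
    MeasurableSet.iUnion fun q => hu.measurableSet_lt_abs_sum_mul _ _
  have hNm : MeasurableSet N := by
    have := hu.measurable
    exact measurableSet_lt measurable_const (by fun_prop)
  have hBadm : MeasurableSet (B₀ ∪ (⋃ k ∈ Finset.range J, B k) ∪ N) :=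
    (hB₀m.union (Finset.measurableSet_biUnion _ fun k _ => hBm k)).union hNm
  refine ⟨(B₀ ∪ (⋃ k ∈ Finset.range J, B k) ∪ N)ᶜ, hBadm.compl, ?_, ?_⟩
  · rw [probReal_compl_eq_one_sub hBadm]
    have h1 : μ.real (B₀ ∪ (⋃ k ∈ Finset.range J, B k) ∪ N)
        ≤ (2 * Real.exp (-(2 * J * ℓ)) + ∑ k ∈ Finset.range J, 2 * Real.exp (-(2 * J * ℓ)))
          + 1 / (4 * n) :=
      (measureReal_union_le _ _).trans <| add_le_add ((measureReal_union_le _ _).trans <|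
        add_le_add hB₀ <| (measureReal_biUnion_finset_le _ _).trans <|
          Finset.sum_le_sum fun k _ => hB k) hN
    rw [Finset.sum_const, Finset.card_range, nsmul_eq_mul] at h1
    have h2 := mul_exp_neg_le hn hι hJ1 hJn
    have h3 : 1 / (2 * (n : ℝ)) = 1 / (4 * n) + 1 / (4 * n) := by field_simp; norm_num
    rw [h3]
    linarith
  · intro ω hω v hv
    simp only [Set.compl_union, Set.mem_inter_iff, Set.mem_compl_iff, Set.mem_iUnion, not_exists,
      B₀, B, N, Set.mem_ofPred_eq, not_lt, Finset.mem_range] at hω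
    obtain ⟨⟨hω₀, hωB⟩, hωN⟩ := hω
    choose s hs using fun k => exists_norm_sub_average_le hv (hm0 k)
    have hmem : ∀ k, average (s k) ∈ l1Ball ι := fun k => average_mem_l1Ball (hm0 k) _
    set Z : EuclideanSpace ℝ ι → ℝ := fun w => ∑ i, u i ω * G w i with hZ
    have hZsub : ∀ w w', Z w - Z w' = ∑ i, u i ω * (G w i - G w' i) := fun w w' => by
      simp only [hZ, mul_sub, Finset.sum_sub_distrib]
    have hroot1 : 1 ≤ √ℓ := Real.one_le_sqrt.2 hℓ1
    have hJ1' : (1 : ℝ) ≤ J := by exact_mod_cast hJ1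
    have hZ₀ : |Z (average (s 0))| ≤ 4 * (σ * C * √ℓ * J) := by
      have h1 := hω₀ (s 0)
      simp only [hG0, sub_zero, hm, pow_zero, mul_one, one_mul] at h1
      refine h1.trans ?_
      rw [Real.sqrt_mul (Nat.cast_nonneg J)]
      have h2 : √(J : ℝ) ≤ J := by
        rw [Real.sqrt_le_left (Nat.cast_nonneg J)]
        nlinarith
      calc 4 * (√(J : ℝ) * √ℓ) * (σ * C) ≤ 4 * (J * √ℓ) * (σ * C) := by gcongr
        _ = _ := by ring
    have hstep : ∀ k < J, |Z (average (s (k + 1))) - Z (average (s k))| ≤ 16 * (σ * C * √ℓ) := by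
      intro k hk
      have hlink : ‖average (s (k + 1)) - average (s k)‖ ≤ 4 / √(m k) := by
        have h1 : 2 / √(m (k + 1) : ℝ) ≤ 2 / √(m k) := by
          have h2 : (m k : ℝ) ≤ m (k + 1) := by
            exact_mod_cast Nat.mul_le_mul_left J (Nat.pow_le_pow_right (by norm_num) (by omega))
          have := Real.sqrt_pos.2 (hmpos k)
          gcongr
        have h3 : average (s (k + 1)) - average (s k)
            = (v - average (s k)) - (v - average (s (k + 1))) := by abel
        rw [h3]
        calc _ ≤ 2 / √(m k : ℝ) + 2 / √(m (k + 1)) :=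
              (norm_sub_le _ _).trans (add_le_add (hs k) (hs (k + 1)))
          _ ≤ 2 / √(m k : ℝ) + 2 / √(m k) := by gcongr
          _ = _ := by ring
      rw [hZsub]
      refine (hωB k hk ⟨(s k, s (k + 1)), hlink⟩).trans (le_of_eq ?_)
      rw [Real.sqrt_mul (Nat.cast_nonneg _)]
      have := (Real.sqrt_pos.2 (hmpos k)).ne'
      field_simp
      ring
    have hchain : ∀ k ≤ J, |Z (average (s k)) - Z (average (s 0))| ≤ k * (16 * (σ * C * √ℓ)) := by
      intro k
      induction k with
      | zero => simp
      | succ k ih =>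
        intro hk
        have h1 := ih (by omega)
        have h2 := hstep k (by omega)
        have h3 := abs_sub_le (Z (average (s (k + 1)))) (Z (average (s k))) (Z (average (s 0)))
        push_cast
        linarith
    have hlast : |Z v - Z (average (s J))| ≤ 2 * (σ * C) := by
      rw [hZsub]
      refine abs_le_of_sq_le_sq ?_ (by positivity)
      have hmn : (n : ℝ) ≤ m J := by
        have : n ≤ m J := by
          simp only [hm]
          nlinarith [Nat.le_mul_of_pos_left (2 ^ J) hJ1]
        exact_mod_cast this
      calc (∑ i, u i ω * (G v i - G (average (s J)) i)) ^ 2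
          ≤ (∑ i, u i ω ^ 2) * ∑ i, (G v i - G (average (s J)) i) ^ 2 :=
            Finset.sum_mul_sq_le_sq_mul_sq _ _ _
        _ ≤ (n * σ ^ 2) * (2 / √(m J) * C) ^ 2 :=
            mul_le_mul hωN (hsq v hv _ (hmem J) _ (hs J)) (by positivity) (by positivity)
        _ = n / m J * (2 * (σ * C)) ^ 2 := by
            rw [mul_pow, div_pow, Real.sq_sqrt (hmpos J).le]
            ring
        _ ≤ (2 * (σ * C)) ^ 2 :=
            mul_le_of_le_one_left (by positivity) ((div_le_one (hmpos J)).2 hmn)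
    -- the first scale contributes `4 J`, the `J` links `16 J`, the remainder `2 ≤ 2 J`
    have hfin : |Z v| ≤ 22 * (σ * C * √ℓ * J) := by
      have h1 := hchain J le_rfl
      have h2 : |Z v| ≤ |Z v - Z (average (s J))| + |Z (average (s J)) - Z (average (s 0))|
          + |Z (average (s 0))| := by
        have h3 := abs_add_le (Z v - Z (average (s J)) + (Z (average (s J)) - Z (average (s 0))))
          (Z (average (s 0)))
        have h4 := abs_add_le (Z v - Z (average (s J))) (Z (average (s J)) - Z (average (s 0)))
        have h5 : Z v = Z v - Z (average (s J)) + (Z (average (s J)) - Z (average (s 0)))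
          + Z (average (s 0)) := by ring
        rw [← h5] at h3
        linarith
      have h6 : σ * C ≤ σ * C * √ℓ * J := by
        have h7 : 0 ≤ σ * C := by positivity
        rw [mul_assoc]
        exact le_mul_of_one_le_right h7 (one_le_mul_of_one_le_of_one_le hroot1 hJ1')
      linarith
    calc |Z v| ≤ 22 * (σ * C * √ℓ * J) := hfin
      _ ≤ 22 * (σ * C * √ℓ * (3 * Real.log (2 * n))) := by
          gcongr
          exact clog_two_mul_le_log hn
      _ = _ := by ring

end Chaining

/-! ### The prediction error of the estimator -/

lemma two_le_P (A : Architecture) : 2 ≤ A.P := by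
  have h : ∀ l ∈ Finset.range (A.L + 1), 1 ≤ A.p (l + 1) * A.p l := fun l hl => by
    have hl := Finset.mem_range.1 hl
    exact Nat.mul_pos (A.one_le_p _ (by omega)) (A.one_le_p _ (by omega))
  have h1 := Finset.card_nsmul_le_sum _ _ 1 h
  have h2 := A.one_le_L
  simp only [Finset.card_range, smul_eq_mul, mul_one] at h1
  exact le_trans (by omega) h1

/-- The basic inequality: if the regularization parameter dominates the noise uniformly over the
unit ball and the regression function is a scaled network, then the estimator has prediction error
at most `2 λ κ*`. -/
lemma predErr_sq_le_of_isEstimator {A : Architecture} {n : ℕ} {h : A.Params → ℝ}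
    {act : A.Activations} {x : Fin n → A.Layer 0} {gstar : A.Layer 0 → ℝ} {u : Fin n → ℝ}
    {lam κs κ : ℝ} {Ws W : A.Params}
    (hlam : ∀ V ∈ unitBall h, 2 / n * |∑ i, u i * net act V (x i)| ≤ lam)
    (hκs : 0 ≤ κs) (hWs : Ws ∈ unitBall h) (hstar : ∀ i, κs * net act Ws (x i) = gstar (x i))
    (hest : IsEstimator h act x (fun i => gstar (x i) + u i) lam (κ, W)) :
    predErr act x gstar κ W ^ 2 ≤ 2 * lam * κs := by
  obtain ⟨⟨hκ, hW⟩, hmin⟩ := hest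
  have hκ : 0 ≤ κ := hκ
  have hobj := isMinOn_iff.1 hmin (κs, Ws) ⟨hκs, hWs⟩
  simp only [objective, hstar] at hobj
  rw [predErr, Real.sq_sqrt (by positivity)]
  have h1 : ∑ i, (gstar (x i) + u i - κ * net act W (x i)) ^ 2
      = ∑ i, (κ * net act W (x i) - gstar (x i)) ^ 2 + ∑ i, (gstar (x i) + u i - gstar (x i)) ^ 2
        - 2 * (κ * ∑ i, u i * net act W (x i) - κs * ∑ i, u i * net act Ws (x i)) := by
    simp only [Finset.mul_sum, ← Finset.sum_sub_distrib, ← Finset.sum_add_distrib]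
    refine Finset.sum_congr rfl fun i _ => ?_
    rw [← hstar i]
    ring
  rw [h1] at hobj
  have h2 : 2 / n * (∑ i, u i * net act W (x i)) ≤ lam :=
    (mul_le_mul_of_nonneg_left (le_abs_self _) (by positivity)).trans (hlam W hW)
  have h3 : 2 / n * (-∑ i, u i * net act Ws (x i)) ≤ lam :=
    (mul_le_mul_of_nonneg_left (neg_le_abs _) (by positivity)).trans (hlam Ws hWs)
  have h4 := mul_le_mul_of_nonneg_left h2 hκ
  have h5 := mul_le_mul_of_nonneg_left h3 hκs
  ring_nf at hobj h4 h5 ⊢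
  linarith

end ScaleReg

theorem corollary1 (K γ : ℝ) (hK : 0 < K) (hγ : 0 < γ) :
    ∃ a : ℝ, 0 < a ∧ ∃ N : ℕ, ∀ n : ℕ, N ≤ n →
      ∀ (A : ScaleReg.Architecture) (act : A.Activations) (aLip : ℝ), 0 ≤ aLip →
      ScaleReg.LipschitzActivations act aLip →
      ∀ (x : Fin n → A.Layer 0) (gstar : A.Layer 0 → ℝ)
        (Ω : Type*) [MeasurableSpace Ω] (μ : Measure Ω) [IsProbabilityMeasure μ]
        (u y : Fin n → Ω → ℝ),
      ScaleReg.IsSubGaussianNoise μ u K γ →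
      (∀ i ω, y i ω = gstar (x i) + u i ω) →
      ∀ lam : ℝ,
      lam = a * (2 * aLip / A.L) ^ A.L * ScaleReg.inputNorm x * √(A.L * Real.log (2 * A.P))
        * (Real.log (2 * n) / √n) →
      ∀ (κs : ℝ) (Ws : A.Params), 0 ≤ κs → Ws ∈ ScaleReg.unitBall ScaleReg.normOne →
      (∀ i, κs * ScaleReg.net act Ws (x i) = gstar (x i)) →
      ∃ E : Set Ω, MeasurableSet E ∧ 1 - 1 / (2 * (n : ℝ)) ≤ μ.real E ∧
        ∀ ω ∈ E, ∀ (κ : ℝ) (W : A.Params),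
          ScaleReg.IsEstimator ScaleReg.normOne act x (fun i => y i ω) lam (κ, W) →
          ScaleReg.predErr act x gstar κ W ^ 2 ≤
            2 * a * κs * (2 * aLip / A.L) ^ A.L * ScaleReg.inputNorm x
              * √(A.L * Real.log (2 * A.P)) * (Real.log (2 * n) / √n) := by
  have hσ := ScaleReg.noiseScale_pos hK γ
  -- `264 = 2 * 66 * 2`: the factor of the cross term in the square, the chaining constant, and
  -- `√(L + 1) ≤ 2 √L`
  refine ⟨264 * ScaleReg.noiseScale K γ, by positivity, 1, ?_⟩
  intro n hn A act aLip ha hact x gstar Ω _ μ _ u y hu hy lam hlam κs Ws hκs hWs hstar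
  have hn' : (0 : ℝ) < n := by exact_mod_cast hn
  have hL : (1 : ℝ) ≤ A.L := by exact_mod_cast A.one_le_L
  have hP := ScaleReg.two_le_P A
  have hlog : 0 ≤ Real.log (2 * n) :=
    Real.log_nonneg (by have : (1 : ℝ) ≤ n := by exact_mod_cast hn
                        linarith)
  set q : ℝ := (2 * aLip / A.L) ^ A.L with hq
  have hq0 : 0 ≤ q := by positivity
  obtain ⟨E, hEm, hE, hbound⟩ := ScaleReg.exists_event_forall_l1Ball_le
    (ι := ScaleReg.Entry A) (by rwa [ScaleReg.card_entry]) hu hK hn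
    (G := fun v i => ScaleReg.net act (ScaleReg.toParams v) (x i))
    (c := fun i => q * √(A.L + 1) * ‖x i‖) (fun i => ScaleReg.net_zero (x i))
    (fun v hv w hw i => ScaleReg.abs_net_toParams_sub_le ha hact hv hw (x i))
  refine ⟨E, hEm, hE, fun ω hω κ W hest => ?_⟩
  have hc : √(∑ i, (q * √(A.L + 1) * ‖x i‖) ^ 2)
      ≤ q * (2 * √A.L) * (√n * ScaleReg.inputNorm x) := by
    have h1 : √((A.L : ℝ) + 1) ≤ 2 * √A.L := by
      rw [Real.sqrt_le_left (by positivity), mul_pow, Real.sq_sqrt (by positivity)]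
      linarith
    have h2 : √n * ScaleReg.inputNorm x = √(∑ i, ‖x i‖ ^ 2) := by
      rw [ScaleReg.inputNorm, ← Real.sqrt_mul hn'.le, mul_div_cancel₀ _ hn'.ne']
    simp only [mul_pow _ ‖x _‖]
    rw [← Finset.mul_sum, Real.sqrt_mul (by positivity), Real.sqrt_sq (by positivity), h2]
    gcongr
  have hdom : ∀ V ∈ ScaleReg.unitBall (A := A) ScaleReg.normOne,
      2 / n * |∑ i, u i ω * ScaleReg.net act V (x i)| ≤ lam := by
    intro V hV
    obtain ⟨v, hv, rfl⟩ := ScaleReg.exists_toParams_eq hV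
    have h1 := hbound ω hω v hv
    rw [ScaleReg.card_entry] at h1
    calc _ ≤ 2 / n * (66 * ScaleReg.noiseScale K γ * (q * (2 * √A.L) * (√n * ScaleReg.inputNorm x))
            * √(Real.log (2 * A.P)) * Real.log (2 * n)) := by
          refine mul_le_mul_of_nonneg_left (h1.trans ?_) (by positivity)
          gcongr
      _ = lam := by
          rw [hlam, Real.sqrt_mul (by positivity)]
          have h2 : (n : ℝ) = √n * √n := (Real.mul_self_sqrt hn'.le).symm
          have h3 : √(n : ℝ) ≠ 0 := (Real.sqrt_pos.2 hn').ne'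
          have h4 : 2 / (n : ℝ) * √n = 2 / √n := by
            nth_rewrite 1 [h2]
            field_simp
          calc _ = (2 / (n : ℝ) * √n) * (66 * ScaleReg.noiseScale K γ * (q * (2 * √A.L)
                * ScaleReg.inputNorm x) * √(Real.log (2 * A.P)) * Real.log (2 * n)) := by ring
            _ = _ := by rw [h4]; ring
  simp only [hy] at hest
  have h := ScaleReg.predErr_sq_le_of_isEstimator hdom hκs hWs hstar hest
  refine h.trans (le_of_eq ?_)
  rw [hlam]
  ring
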